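/- An mm-space is a triple $X=(X,d_X,\mu_X)$ where $(X,d_X)$ is a complete separable metric space and $\mu_X$ is a Borel probability measure on it; it is finite if the set $X$ is finite. A parameter of $X$ is a Borel map $\varphi:I\to X$ on the unit interval $I=[0,1]$ with $\varphi_*\mathcal{L}^1=\mu_X$, where $\mathcal{L}^1$ is Lebesgue measure. The box distance $\Box(X,Y)$ of two mm-spaces is the infimum of all $\varepsilon\ge 0$ for which there are parameters $\varphi$ of $X$ and $\psi$ of $Y$ and a Borel set $I_0\subset I$ with $\mathcal{L}^1(I_0)\ge 1-\varepsilon$ and $|d_X(\varphi(s),\varphi(t))-d_Y(\psi(s),\psi(t))|\le\varepsilon$ for all $s,t\in I_0$. A set $\mathcal{Y}$ of mm-spaces is $\Box$-precompact if it is totally bounded with respect to $\Box$; as $\Box$ is a complete metric on the set of isomorphism classes of mm-spaces, this is equivalent to $\mathcal{Y}$ having compact closure. For an mm-space $X$, a set $\mathcal{Y}$ of mm-spaces and $\varepsilon>0$, write $\mathcal{Y}\prec_{\varepsilon,0}X$ if for every $Y\in\mathcal{Y}$ there is a Borel map $f:X\to Y$ such that $d_Y(f(x),f(x'))\le d_X(x,x')+\varepsilon$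 for all $x,x'\in X$ and $d_P(f_*\mu_X,\mu_Y)\le\varepsilon$, where $d_P$ is the Prohorov distance. (That is, $Y\prec_\varepsilon X$ holds with non-exceptional domain all of $X$.) **Corollary.** If $\mathcal{Y}$ is a $\Box$-precompact set of mm-spaces and $\varepsilon>0$, then there exists a finite mm-space $X$ with $\mathcal{Y}\prec_{\varepsilon,0}X$. -/

import Mathlib

open MeasureTheory ProbabilityTheory
open scoped unitInterval

universe u

/-- A metric measure space (mm-space): a complete separable metric space with a Borel
probability measure. -/
structure MMSpace : Type (u + 1) where
  carrier : Type u
  [metricSpace : MetricSpace carrier]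
  [measurableSpace : MeasurableSpace carrier]
  [borelSpace : BorelSpace carrier]
  [completeSpace : CompleteSpace carrier]
  [separableSpace : TopologicalSpace.SeparableSpace carrier]
  μ : Measure carrier
  [isProbabilityMeasure : IsProbabilityMeasure μ]

namespace MMSpace

instance : CoeSort MMSpace.{u} (Type u) := ⟨carrier⟩

attribute [instance] metricSpace measurableSpace borelSpace completeSpace separableSpace
  isProbabilityMeasure

/-- A parameter of `X`: a Borel map from the unit interval `I` to `X` that pushes Lebesgue measure
forward to `μ_X`. -/
def IsParameter (X : MMSpace.{u}) (φ : I → X) : Prop :=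
  Measurable φ ∧ (volume : Measure I).map φ = X.μ

/-- `ε` is admissible for `X` and `Y`: there are parameters `φ` of `X` and `ψ` of `Y` whose pulled
back metrics differ by at most `ε` on a Borel set of Lebesgue measure at least `1 - ε`. -/
def BoxAdmissible (X Y : MMSpace.{u}) (ε : ℝ) : Prop :=
  0 ≤ ε ∧ ∃ (φ : I → X) (ψ : I → Y) (I₀ : Set I),
    X.IsParameter φ ∧ Y.IsParameter ψ ∧ MeasurableSet I₀ ∧
      1 - ε ≤ (volume : Measure I).real I₀ ∧
      ∀ s ∈ I₀, ∀ t ∈ I₀, |dist (φ s) (φ t) - dist (ψ s) (ψ t)| ≤ ε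

/-- The box distance `□(X, Y)`. -/
noncomputable def boxDist (X Y : MMSpace.{u}) : ℝ :=
  sInf {ε : ℝ | BoxAdmissible X Y ε}

/-! The box distance is a pseudometric on mm-spaces. -/

instance (X : MMSpace.{u}) : Nonempty X :=
  nonempty_of_isProbabilityMeasure X.μ

instance (X : MMSpace.{u}) : SecondCountableTopology X :=
  UniformSpace.secondCountable_of_separable X

theorem exists_isParameter (X : MMSpace.{u}) : ∃ φ : I → X, X.IsParameter φ :=
  MeasureTheory.Measure.exists_measurable_map_eq X.μ

theorem boxAdmissible_one (X Y : MMSpace.{u}) : BoxAdmissible X Y 1 := by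
  obtain ⟨φ, hφ⟩ := X.exists_isParameter
  obtain ⟨ψ, hψ⟩ := Y.exists_isParameter
  exact ⟨zero_le_one, φ, ψ, ∅, hφ, hψ, MeasurableSet.empty, by simp, by simp⟩

theorem boxAdmissible_self (X : MMSpace.{u}) : BoxAdmissible X X 0 := by
  obtain ⟨φ, hφ⟩ := X.exists_isParameter
  exact ⟨le_rfl, φ, φ, Set.univ, hφ, hφ, MeasurableSet.univ, by simp, by simp⟩

theorem BoxAdmissible.symm {X Y : MMSpace.{u}} {ε : ℝ} (h : BoxAdmissible X Y ε) :
    BoxAdmissible Y X ε := by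
  obtain ⟨h0, φ, ψ, S, hφ, hψ, hS, hv, hd⟩ := h
  exact ⟨h0, ψ, φ, S, hψ, hφ, hS, hv, fun s hs t ht => by
    rw [abs_sub_comm]; exact hd s hs t ht⟩

/-- Two parameters of the same mm-space agree almost everywhere after suitable measure preserving
reparametrizations. -/
theorem exists_reparametrization {Y : MMSpace.{u}} {a b : I → Y} (ha : Y.IsParameter a)
    (hb : Y.IsParameter b) :
    ∃ p q : I → I, MeasurePreserving p volume volume ∧ MeasurePreserving q volume volume ∧
      ∀ᵐ s : I, a (p s) = b (q s) := by
  obtain ⟨ham, hae⟩ := ha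
  obtain ⟨hbm, hbe⟩ := hb
  let κ : Kernel Y I := condDistrib id b (volume : Measure I)
  have hκ : ((volume : Measure I).map b) ⊗ₘ κ = (volume : Measure I).map (fun s => (b s, s)) :=
    compProd_map_condDistrib (X := b) (Y := id) (μ := (volume : Measure I)) aemeasurable_id
  let m : Measure (I × I) := volume ⊗ₘ (κ.comap a ham)
  have hm : m.map (Prod.map a id) = (volume : Measure I).map (fun s => (b s, s)) := by
    rw [← hκ, hbe, ← hae]
    refine Measure.ext_of_lintegral _ fun g hg => ?_
    rw [lintegral_map hg (by fun_prop), Measure.lintegral_compProd (by fun_prop),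
      Measure.lintegral_compProd hg, lintegral_map (by fun_prop) ham]
    simp [Kernel.comap_apply]
  have hfst : m.map Prod.fst = volume := Measure.fst_compProd _ _
  have hsnd : m.map Prod.snd = volume := by
    have h := congrArg (Measure.map Prod.snd) hm
    rw [Measure.map_map (by fun_prop) (by fun_prop),
      Measure.map_map (by fun_prop) (by fun_prop)] at h
    have h2 : (Prod.snd ∘ fun s : I => (b s, s)) = id := rfl
    have h1 : (Prod.snd ∘ Prod.map a (id : I → I)) = Prod.snd := rfl
    rwa [h1, h2, Measure.map_id] at h
  have heq : ∀ᵐ z ∂m, a z.1 = b z.2 := by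
    have hset : MeasurableSet {w : Y × I | w.1 = b w.2} :=
      measurableSet_eq_fun (by fun_prop) (by fun_prop)
    have h : ∀ᵐ w ∂(m.map (Prod.map a id)), w.1 = b w.2 := by
      rw [hm, ae_map_iff (by fun_prop) hset]
      exact Filter.Eventually.of_forall fun _ => rfl
    exact (ae_map_iff (by fun_prop) hset).1 h
  obtain ⟨r, hrm, hr⟩ := MeasureTheory.Measure.exists_measurable_map_eq m
  refine ⟨fun s => (r s).1, fun s => (r s).2, ⟨by fun_prop, ?_⟩, ⟨by fun_prop, ?_⟩, ?_⟩
  · exact (Measure.map_map measurable_fst hrm).symm.trans (by rw [hr, hfst])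
  · exact (Measure.map_map measurable_snd hrm).symm.trans (by rw [hr, hsnd])
  · rw [← hr] at heq
    exact ae_of_ae_map hrm.aemeasurable heq

theorem BoxAdmissible.trans {X Y Z : MMSpace.{u}} {δ ε : ℝ} (h : BoxAdmissible X Y δ)
    (h' : BoxAdmissible Y Z ε) : BoxAdmissible X Z (δ + ε) := by
  obtain ⟨h0, φ, ψ, S, hφ, hψ, hS, hv, hd⟩ := h
  obtain ⟨h0', ψ', χ, S', hψ', hχ, hS', hv', hd'⟩ := h'
  obtain ⟨p, q, hp, hq, hpq⟩ := exists_reparametrization hψ hψ'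
  have hE : MeasurableSet {s : I | ψ (p s) = ψ' (q s)} :=
    measurableSet_eq_fun (hψ.1.comp hp.measurable) (hψ'.1.comp hq.measurable)
  have hA : MeasurableSet (p ⁻¹' S) := hp.measurable hS
  have hB : MeasurableSet (q ⁻¹' S') := hq.measurable hS'
  refine ⟨add_nonneg h0 h0', φ ∘ p, χ ∘ q, p ⁻¹' S ∩ q ⁻¹' S' ∩ {s | ψ (p s) = ψ' (q s)},
    ⟨hφ.1.comp hp.measurable, ?_⟩, ⟨hχ.1.comp hq.measurable, ?_⟩, (hA.inter hB).inter hE, ?_, ?_⟩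
  · rw [← Measure.map_map hφ.1 hp.measurable, hp.map_eq, hφ.2]
  · rw [← Measure.map_map hχ.1 hq.measurable, hq.map_eq, hχ.2]
  · have e : (volume : Measure I).real (p ⁻¹' S ∩ q ⁻¹' S' ∩ {s | ψ (p s) = ψ' (q s)}) =
        (volume : Measure I).real (p ⁻¹' S ∩ q ⁻¹' S') := by
      refine measureReal_congr ?_
      filter_upwards [hpq] with s hs
      exact propext ⟨fun h => h.1, fun h => ⟨h, hs⟩⟩
    have eA : (volume : Measure I).real (p ⁻¹' S) = (volume : Measure I).real S := by
      simp only [Measure.real, hp.measure_preimage hS.nullMeasurableSet]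
    have eB : (volume : Measure I).real (q ⁻¹' S') = (volume : Measure I).real S' := by
      simp only [Measure.real, hq.measure_preimage hS'.nullMeasurableSet]
    have u1 := measureReal_union_add_inter (μ := (volume : Measure I)) (s := p ⁻¹' S) hB
    have u2 : (volume : Measure I).real (p ⁻¹' S ∪ q ⁻¹' S') ≤ 1 := measureReal_le_one
    rw [e]
    linarith
  · rintro s ⟨⟨hs, hs'⟩, hs''⟩ t ⟨⟨ht, ht'⟩, ht''⟩
    have e1 := hd _ hs _ ht
    have e2 := hd' _ hs' _ ht'
    have hs3 : ψ (p s) = ψ' (q s) := hs''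
    have ht3 : ψ (p t) = ψ' (q t) := ht''
    rw [hs3, ht3] at e1
    exact (abs_sub_le _ _ _).trans (add_le_add e1 e2)

theorem boxDist_le {X Y : MMSpace.{u}} {ε : ℝ} (h : BoxAdmissible X Y ε) : boxDist X Y ≤ ε :=
  csInf_le ⟨0, fun _ hx => hx.1⟩ h

theorem exists_boxAdmissible_lt {X Y : MMSpace.{u}} {r : ℝ} (h : boxDist X Y < r) :
    ∃ ε < r, BoxAdmissible X Y ε := by
  obtain ⟨ε, hε, hr⟩ := exists_lt_of_csInf_lt ⟨1, boxAdmissible_one X Y⟩ h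
  exact ⟨ε, hr, hε⟩

/-- The box distance as a pseudometric on all mm-spaces. -/
noncomputable instance : PseudoMetricSpace MMSpace.{u} where
  dist := boxDist
  dist_self X := le_antisymm (boxDist_le X.boxAdmissible_self)
    (le_csInf ⟨1, boxAdmissible_one X X⟩ fun _ h => h.1)
  dist_comm X Y := congrArg sInf (Set.ext fun _ => ⟨fun h => h.symm, fun h => h.symm⟩)
  dist_triangle X Y Z := by
    refine le_of_forall_pos_le_add fun η hη => ?_
    obtain ⟨a, ha, ha'⟩ := exists_boxAdmissible_lt (lt_add_of_pos_right (boxDist X Y) (half_pos hη))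
    obtain ⟨b, hb, hb'⟩ := exists_boxAdmissible_lt (lt_add_of_pos_right (boxDist Y Z) (half_pos hη))
    have := boxDist_le (ha'.trans hb')
    linarith

/-- `Y ≺_ε X` with non-exceptional domain `S`: there is a Borel map `f : X → Y` that is
`1`-Lipschitz up to the additive error `ε` on `S`, where `S` is a Borel set with `μ_X S ≥ 1 - ε`,
and whose pushforward `f_* μ_X` has Prohorov distance at most `ε` from `μ_Y`. -/
def EpsDominatesOn (ε : ℝ) (X Y : MMSpace.{u}) (S : Set X) : Prop :=
  MeasurableSet S ∧ 1 - ε ≤ X.μ.real S ∧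
    ∃ f : X → Y, Measurable f ∧
      (∀ x ∈ S, ∀ x' ∈ S, dist (f x) (f x') ≤ dist x x' + ε) ∧
      levyProkhorovDist (X.μ.map f) Y.μ ≤ ε

/-- `𝒴 ≺_{ε,0} X`: every `Y ∈ 𝒴` satisfies `Y ≺_ε X` with non-exceptional domain the whole
of `X`. -/
def EpsZeroDominates (ε : ℝ) (X : MMSpace.{u}) (𝒴 : Set MMSpace.{u}) : Prop :=
  ∀ Y ∈ 𝒴, EpsDominatesOn ε X Y Set.univ

end MMSpace

open Metric Filter
open scoped ENNReal Topology

/-! Finitely many small balls cover the family, and a product of finite spaces dominates whatever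
its factors dominate, so one ball suffices (`exists_finite_dominates_ball`). Replace its centre by a
finite space `F`. Each `Y` in the ball is compared with `F` by parameters `φ`, `ψ` on a good set
`S`, and `T = φ '' S` is one of finitely many subsets of `F`. For fixed `T`, the space `T` itself
dominates: send each point `x` of `T` to `ψ s` for some `s ∈ S` over `x`. Points of `F` outside `T`
are discarded, so no exceptional set remains. -/

theorem levyProkhorovDist_map_le {Ω E : Type*} [MeasurableSpace Ω] {P : Measure Ω}
    [IsProbabilityMeasure P] [MeasurableSpace E] [PseudoMetricSpace E] [OpensMeasurableSpace E]
    {a b : Ω → E} (ha : Measurable a) (hb : Measurable b) {S : Set Ω} (hS : MeasurableSet S)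
    {δ : ℝ} (hδ : 0 ≤ δ) (hPS : 1 - δ ≤ P.real S) (hab : ∀ s ∈ S, dist (a s) (b s) ≤ δ) :
    levyProkhorovDist (P.map a) (P.map b) ≤ δ := by
  have hc : P Sᶜ ≤ ENNReal.ofReal δ := by
    rw [← ofReal_measureReal]
    apply ENNReal.ofReal_le_ofReal
    rw [probReal_compl_eq_one_sub hS]
    linarith
  have key : ∀ {f g : Ω → E}, Measurable f → Measurable g → (∀ s ∈ S, dist (f s) (g s) ≤ δ) →
      ∀ (r : ℝ≥0∞) (B : Set E), ENNReal.ofReal δ < r → r < ∞ → MeasurableSet B →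
        P.map f B ≤ P.map g (thickening r.toReal B) + r := by
    intro f g hf hg hfg r B hr hr' hB
    rw [Measure.map_apply hf hB, Measure.map_apply hg isOpen_thickening.measurableSet]
    -- On `S` the two maps differ by at most `δ < r`; the rest has mass at most `δ`.
    have hsub : f ⁻¹' B ⊆ g ⁻¹' thickening r.toReal B ∪ Sᶜ := by
      intro s hs
      by_cases hsS : s ∈ S
      · refine Or.inl (mem_thickening_iff.2 ⟨f s, hs, ?_⟩)
        rw [dist_comm]
        exact (hfg s hsS).trans_lt ((ENNReal.ofReal_lt_iff_lt_toReal hδ hr'.ne).1 hr)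
      · exact Or.inr hsS
    calc P (f ⁻¹' B) ≤ P (g ⁻¹' thickening r.toReal B) + P Sᶜ :=
          (measure_mono hsub).trans (measure_union_le _ _)
      _ ≤ _ := by gcongr; exact hc.trans hr.le
  refine ENNReal.toReal_le_of_le_ofReal hδ (levyProkhorovEDist_le_of_forall _ _ _ ?_)
  exact fun r B hr hr' hB => ⟨key ha hb hab r B hr hr' hB,
    key hb ha (fun s hs => dist_comm (a s) (b s) ▸ hab s hs) r B hr hr' hB⟩

namespace MMSpace

/-- The finite subset `T` of `Y` with the image of `μ_Y` under a Borel map `p : Y → T`. -/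
noncomputable def finiteSubspace (Y : MMSpace.{u}) (T : Set Y) [Finite T] (p : Y → T)
    (hp : Measurable p) : MMSpace.{u} where
  carrier := T
  μ := Y.μ.map p
  completeSpace := complete_of_compact
  isProbabilityMeasure := Measure.isProbabilityMeasure_map hp.aemeasurable

theorem exists_finite_boxAdmissible (Y : MMSpace.{u}) {δ : ℝ} (hδ : 0 < δ) :
    ∃ F : MMSpace.{u}, Finite F ∧ BoxAdmissible Y F δ := by
  let e := TopologicalSpace.denseSeq Y
  -- Convergence in measure gives a finite-valued `q` moving points by less than `δ / 2` off a set
  -- of mass below `δ`.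
  have htend : TendstoInMeasure Y.μ (fun n x => SimpleFunc.nearestPt e n x) atTop id := by
    refine tendstoInMeasure_of_tendsto_ae
      (fun n => (SimpleFunc.nearestPt e n).measurable.aestronglyMeasurable) ?_
    exact Eventually.of_forall fun x =>
      SimpleFunc.tendsto_nearestPt (TopologicalSpace.denseRange_denseSeq Y x)
  obtain ⟨n, hn⟩ := (((tendstoInMeasure_iff_measureReal_dist.1 htend (δ / 2)
    (half_pos hδ))).eventually (gt_mem_nhds hδ)).exists
  let q := SimpleFunc.nearestPt e n
  have : Finite (Set.range q) := q.finite_range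
  let p : Y → Set.range q := fun y => ⟨q y, y, rfl⟩
  have hp : Measurable p := q.measurable.subtype_mk
  obtain ⟨φ, hφm, hφ⟩ := Y.exists_isParameter
  have hA : MeasurableSet {x : Y | δ / 2 ≤ dist (q x) x} :=
    measurableSet_le measurable_const (q.measurable.dist measurable_id)
  refine ⟨Y.finiteSubspace (Set.range q) p hp, this, hδ.le, φ, p ∘ φ,
    φ ⁻¹' {x : Y | δ / 2 ≤ dist (q x) x}ᶜ, ⟨hφm, hφ⟩, ⟨hp.comp hφm, ?_⟩, hφm hA.compl, ?_, ?_⟩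
  · exact (Measure.map_map hp hφm).symm.trans (by rw [hφ]; rfl)
  · rw [← map_measureReal_apply hφm hA.compl, hφ, probReal_compl_eq_one_sub hA]
    have : Y.μ.real {x : Y | δ / 2 ≤ dist (q x) x} < δ := hn
    linarith
  · intro s hs t ht
    have hs' : dist (q (φ s)) (φ s) < δ / 2 := not_le.1 hs
    have ht' : dist (q (φ t)) (φ t) < δ / 2 := not_le.1 ht
    change |dist (φ s) (φ t) - dist (q (φ s)) (q (φ t))| ≤ δ
    have := dist_dist_dist_le (φ s) (φ t) (q (φ s)) (q (φ t))
    rw [Real.dist_eq, dist_comm (φ s) (q _), dist_comm (φ t) (q _)] at this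
    linarith

/-- The mm-spaces `Y` with `□(F, Y) ≤ ε` witnessed by a Borel set of parameters that visits
exactly the points of `T`. -/
def boxNearWithSupport (F : MMSpace.{u}) (ε : ℝ) (T : Set F) : Set MMSpace.{u} :=
  {Y | ∃ (φ : I → F) (ψ : I → Y) (S : Set I), F.IsParameter φ ∧ Y.IsParameter ψ ∧
    MeasurableSet S ∧ 1 - ε ≤ (volume : Measure I).real S ∧
    (∀ s ∈ S, ∀ t ∈ S, |dist (φ s) (φ t) - dist (ψ s) (ψ t)| ≤ ε) ∧ φ '' S = T}

/-- The dominating space depends only on `F` and `T`, so it serves all such `Y` at once. -/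
theorem exists_finite_dominates_boxNearWithSupport (F : MMSpace.{u}) [Finite F] {ε : ℝ}
    (hε : 0 ≤ ε) {T : Set F} (hT : T.Nonempty) :
    ∃ X : MMSpace.{u}, Finite X ∧ EpsZeroDominates ε X (F.boxNearWithSupport ε T) := by
  classical
  obtain ⟨t₀, ht₀⟩ := hT
  -- The value off `T` is immaterial, since `φ` maps `S` into `T`.
  let p : F → T := fun x => if h : x ∈ T then ⟨x, h⟩ else ⟨t₀, ht₀⟩
  have hp : Measurable p := measurable_of_finite p
  have hpT : ∀ x (h : x ∈ T), p x = ⟨x, h⟩ := fun x h => dif_pos h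
  refine ⟨F.finiteSubspace T p hp, inferInstanceAs (Finite T), ?_⟩
  rintro Y ⟨φ, ψ, S, ⟨hφm, hφ⟩, ⟨hψm, hψ⟩, hS, hv, hd, hST⟩
  have hsec : ∀ x : T, ∃ s ∈ S, φ s = x := fun x => hST.ge x.2
  choose u huS hu using hsec
  have hg : Measurable fun x : T => ψ (u x) := measurable_of_finite _
  refine ⟨MeasurableSet.univ, ?_, fun x : T => ψ (u x), hg, ?_, ?_⟩
  · rw [probReal_univ]; linarith
  · intro (x : T) _ (x' : T) _
    have h := (abs_le.1 (hd _ (huS x) _ (huS x'))).1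
    rw [hu, hu] at h
    change dist (ψ (u x)) (ψ (u x')) ≤ dist (x : F) (x' : F) + ε
    linarith
  · have hmap : (F.finiteSubspace T p hp).μ.map (fun x : T => ψ (u x)) =
        (volume : Measure I).map fun s => ψ (u (p (φ s))) := by
      change (F.μ.map p).map (fun x : T => ψ (u x)) = _
      rw [← hφ, Measure.map_map hp hφm, Measure.map_map hg (hp.comp hφm)]
      rfl
    refine (congrArg₂ levyProkhorovDist hmap hψ.symm).trans_le ?_
    refine levyProkhorovDist_map_le (hg.comp (hp.comp hφm)) hψm hS hε hv fun s hs => ?_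
    have hsT : φ s ∈ T := hST ▸ Set.mem_image_of_mem φ hs
    -- Both parameters lie in `S` over the same point of `T`, so their `ψ`-images are `ε`-close.
    have h := (abs_le.1 (hd _ (huS (p (φ s))) s hs)).1
    rw [hu, hpT _ hsT, dist_self] at h
    change dist (ψ (u (p (φ s)))) (ψ s) ≤ ε
    rw [hpT _ hsT]
    linarith

theorem EpsZeroDominates.comp {ε : ℝ} {X X' : MMSpace.{u}} {𝒴 : Set MMSpace.{u}}
    (h : EpsZeroDominates ε X 𝒴) {g : X' → X} (hg : MeasurePreserving g X'.μ X.μ)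
    (hlip : ∀ x x', dist (g x) (g x') ≤ dist x x') : EpsZeroDominates ε X' 𝒴 := by
  intro Y hY
  obtain ⟨-, hv, f, hf, hd, hP⟩ := h Y hY
  refine ⟨MeasurableSet.univ, ?_, f ∘ g, hf.comp hg.measurable, fun x _ x' _ => ?_, ?_⟩
  · simpa using hv
  · exact (hd _ trivial _ trivial).trans (by gcongr; exact hlip x x')
  · rwa [← Measure.map_map hf hg.measurable, hg.map_eq]

/-- The product of two mm-spaces, with the maximum metric. -/
noncomputable def prod (X X' : MMSpace.{u}) : MMSpace.{u} where
  carrier := X × X'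
  μ := X.μ.prod X'.μ

/-- Projections of the product are `1`-Lipschitz for the maximum metric and measure preserving. -/
theorem exists_finite_dominates_union {ε : ℝ} {𝒴 𝒵 : Set MMSpace.{u}}
    (h : ∃ X : MMSpace.{u}, Finite X ∧ EpsZeroDominates ε X 𝒴)
    (h' : ∃ X : MMSpace.{u}, Finite X ∧ EpsZeroDominates ε X 𝒵) :
    ∃ X : MMSpace.{u}, Finite X ∧ EpsZeroDominates ε X (𝒴 ∪ 𝒵) := by
  obtain ⟨X, _, h⟩ := h
  obtain ⟨X', _, h'⟩ := h'
  refine ⟨X.prod X', inferInstanceAs (Finite (X × X')), ?_⟩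
  rintro Y (hY | hY)
  · exact h.comp (X' := X.prod X') (g := Prod.fst) measurePreserving_fst
      (fun _ _ => le_max_left _ _) Y hY
  · exact h'.comp (X' := X.prod X') (g := Prod.snd) measurePreserving_snd
      (fun _ _ => le_max_right _ _) Y hY

theorem exists_finite_dominates_empty (ε : ℝ) :
    ∃ X : MMSpace.{u}, Finite X ∧ EpsZeroDominates ε X ∅ :=
  ⟨{ carrier := PUnit.{u + 1}, μ := Measure.dirac PUnit.unit },
    (inferInstance : Finite PUnit.{u + 1}), fun _ h => h.elim⟩

theorem exists_finite_dominates_biUnion {ι : Type*} {ε : ℝ} {t : Set ι} (ht : t.Finite)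
    {𝒴 : ι → Set MMSpace.{u}}
    (h : ∀ i ∈ t, ∃ X : MMSpace.{u}, Finite X ∧ EpsZeroDominates ε X (𝒴 i)) :
    ∃ X : MMSpace.{u}, Finite X ∧ EpsZeroDominates ε X (⋃ i ∈ t, 𝒴 i) := by
  induction t, ht using Set.Finite.induction_on with
  | empty => simpa using exists_finite_dominates_empty ε
  | insert _ _ ih =>
    rw [Set.biUnion_insert]
    exact exists_finite_dominates_union (h _ (Set.mem_insert _ _))
      (ih fun i hi => h i (Set.mem_insert_of_mem _ hi))

theorem exists_finite_dominates_ball {δ : ℝ} (hδ : 0 < δ) (hδ1 : δ < 1) (Y₀ : MMSpace.{u}) :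
    ∃ X : MMSpace.{u}, Finite X ∧ EpsZeroDominates δ X (ball Y₀ (δ / 2)) := by
  obtain ⟨F, hF, hYF⟩ := Y₀.exists_finite_boxAdmissible (half_pos hδ)
  obtain ⟨X, hX, hdom⟩ := exists_finite_dominates_biUnion (ε := δ)
    (t := {T : Set F | T.Nonempty}) (𝒴 := F.boxNearWithSupport δ) (Set.toFinite _)
    fun T hT => F.exists_finite_dominates_boxNearWithSupport hδ.le hT
  refine ⟨X, hX, fun Y hY => hdom Y ?_⟩
  obtain ⟨r, hr, hYr⟩ := exists_boxAdmissible_lt (mem_ball'.1 hY)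
  obtain ⟨-, φ, ψ, S, hφ, hψ, hS, hv, hd⟩ := hYF.symm.trans hYr
  have hle : δ / 2 + r ≤ δ := by linarith
  refine Set.mem_biUnion (x := φ '' S) ?_ ⟨φ, ψ, S, hφ, hψ, hS, by linarith,
    fun s hs t ht => (hd s hs t ht).trans hle, rfl⟩
  -- Since `δ < 1`, the good set has positive measure.
  refine Set.Nonempty.image _ (Set.nonempty_iff_ne_empty.2 ?_)
  rintro rfl
  rw [measureReal_empty] at hv
  linarith

theorem EpsZeroDominates.mono {δ ε : ℝ} (hδε : δ ≤ ε) {X : MMSpace.{u}} {𝒴 : Set MMSpace.{u}}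
    (h : EpsZeroDominates δ X 𝒴) : EpsZeroDominates ε X 𝒴 := by
  intro Y hY
  obtain ⟨hm, hv, f, hf, hd, hP⟩ := h Y hY
  exact ⟨hm, by linarith, f, hf, fun x hx x' hx' => (hd x hx x' hx').trans (by linarith),
    hP.trans hδε⟩

end MMSpace

theorem mainTheorem7 (𝒴 : Set MMSpace.{u}) (h𝒴 : TotallyBounded 𝒴) (ε : ℝ) (hε : 0 < ε) :
    ∃ X : MMSpace.{u}, Finite X ∧ MMSpace.EpsZeroDominates ε X 𝒴 := by
  -- The cap keeps the error below `1`, so that good sets are nonempty.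
  have hδ : 0 < min ε (1 / 2) := lt_min hε (by norm_num)
  have hδ1 : min ε (1 / 2) < 1 := (min_le_right _ _).trans_lt (by norm_num)
  obtain ⟨t, ht, hcover⟩ := Metric.totallyBounded_iff.1 h𝒴 _ (half_pos hδ)
  obtain ⟨X, hX, hdom⟩ := MMSpace.exists_finite_dominates_biUnion ht
    fun Y₀ _ => MMSpace.exists_finite_dominates_ball hδ hδ1 Y₀
  exact ⟨X, hX, fun Y hY => hdom.mono (min_le_left _ _) Y (hcover hY)⟩
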